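/- **Lemma 1 (One-Shot-Deviation Principle).** A two-player revision game consists of a nonempty interval $A\subseteq\mathbb R$ of actions, continuous stage payoffs $\pi_1,\pi_2:A\times A\to\mathbb R$, a horizon $T>0$ and a rate $\lambda>0$. The players choose actions simultaneously at time $-T$, and can revise them simultaneously at each arrival of a Poisson process of rate $\lambda$ on $(-T,0]$; the stage payoffs are realized once, at the deadline $0$, at the action profile chosen last. Write $t\in[0,T]$ for the remaining time at calendar time $-t$. (a) *Strategies as functions of time.* Let a strategy of player $i$ be a measurable map $\sigma_i:[0,T]\to A$, and let the expected payoff of player $i$ in the subgame beginning at $-t$ be $$V_i(\sigma,t)=\pi_i(\sigma(t))e^{-\lambda t}+\int_0^t\pi_i(\sigma(s))\,\lambda e^{-\lambda s}\,ds .$$ Let $\sigma$ be a strategy profile with $\pi_i(\sigma(\cdot))$ integrable for both $i$. Then $\sigma$ is a subgame perfect equilibrium, i.e. $V_i((\sigma_i',\sigma_{-i}),t)\le V_i(\sigma,t)$ for all $i$, all $t\in[0,T]$ and all strategies $\sigma_i'$ for which $\pi_i(\sigma_i'(\cdot),\sigma_{-i}(\cdot))$ is integrable, if and only if no player has a profitable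 one-shot deviation at any time, i.e. there are no $i$, $t\in[0,T]$ and $\sigma_i':[0,T]\to A$ that differs from $\sigma_i$ at $t$ and only at $t$ with $V_i((\sigma_i',\sigma_{-i}),t)>V_i(\sigma,t)$. (b) *History-dependent strategies.* A history $h$ is the finite list of the past times at which actions were chosen together with the action profiles chosen then. A node $(h,t)$ is the empty history with $t=T$, or a nonempty history whose choice times start at $T$ and strictly decrease (as remaining times), together with a revision opportunity at a remaining time $t$ smaller than all of them. Let a strategy of player $i$ be a measurable map from pairs (history, current time) to actions whose values lie in a compact subset of $A$, and let $V_i(\sigma,h,t)$ be the expected payoff of player $i$ when $\sigma$ is played from $(h,t)$ on (including the choice at $t$). Then a strategy profile $\sigma$ is a subgame perfect equilibrium, i.e. $V_i((\sigma_i',\sigma_{-i}),h,t)\le V_i(\sigma,h,t)$ for all $i$, all nodes $(h,t)$ and all strategies $\sigma_i'$, if and only if no player has a profitable one-shot deviation at any node, i.e. there are no $i$, node $(h,t)$ and strategy $\sigma_i'$ that differs from $\sigma_i$ at $(h,t)$ and only there with $V_i((\sigma_i',\sigma_{-i}),h,t)>V_i(\sigma,h,t)$. -/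

import Mathlib

open MeasureTheory

noncomputable section

/-- A two-player revision game: a stage game on an interval `A` of actions with continuous payoffs,
a length `T > 0` and a Poisson arrival rate `rate > 0` of revision opportunities.
Symmetry of the payoffs is not required. -/
structure RevisionGame where
  /-- the common action set -/
  A : Set ℝ
  A_nonempty : A.Nonempty
  A_interval : A.OrdConnected
  /-- `payoff i a` is the stage payoff of player `i` at the action profile `a` -/
  payoff : Fin 2 → (Fin 2 → A) → ℝ
  payoff_continuous : ∀ i, Continuous (payoff i)
  /-- the game runs over the calendar times `[-T, 0]` -/
  T : ℝ
  T_pos : 0 < T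
  /-- the arrival rate of revision opportunities -/
  rate : ℝ
  rate_pos : 0 < rate

namespace RevisionGame

variable (G : RevisionGame)

/-- Times, measured by the remaining length `t ∈ [0, T]`: `t` stands for the calendar time `-t`. -/
abbrev Time : Type := Set.Icc (0 : ℝ) G.T

/-- The starting time. -/
def start : G.Time := ⟨G.T, G.T_pos.le, le_rfl⟩

/-- Lebesgue measure on the times `[0, T]`. -/
def timeMeasure : Measure G.Time := Measure.comap Subtype.val volume

/-- Action profiles. -/
abbrev Profile : Type := Fin 2 → G.A

/-! ### Strategies that are functions of time -/

/-- A plan: a strategy given by a map from times to actions. -/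
abbrev Plan : Type := G.Time → G.A

/-- The plan profile `σ` is measurable and gives player `i` a well-defined expected payoff. -/
def PlanWellDefined (σ : Fin 2 → G.Plan) (i : Fin 2) : Prop :=
  (∀ j, Measurable (σ j)) ∧ Integrable (fun s : G.Time => G.payoff i (fun j => σ j s)) G.timeMeasure

/-- Expected payoff of player `i` in the subgame that begins at remaining time `t`:
`π_i(σ(t)) e^{-λ t} + ∫_0^t π_i(σ(s)) λ e^{-λ s} ds`. -/
def planValue (σ : Fin 2 → G.Plan) (i : Fin 2) (t : G.Time) : ℝ :=
  G.payoff i (fun j => σ j t) * Real.exp (-G.rate * t) +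
    ∫ s in Set.Iic t, G.payoff i (fun j => σ j s) * (G.rate * Real.exp (-G.rate * s)) ∂G.timeMeasure

/-- Subgame perfection among plans: in every subgame, no plan of a player yields more. -/
def IsPlanSPE (σ : Fin 2 → G.Plan) : Prop :=
  ∀ (i : Fin 2) (τ : G.Plan), G.PlanWellDefined (Function.update σ i τ) i →
    ∀ t : G.Time, G.planValue (Function.update σ i τ) i t ≤ G.planValue σ i t

/-- `τ` is a one-shot deviation from the plan `ρ` at `t`: it differs from `ρ` at `t` and only
there. -/
def IsPlanOneShotDeviation (ρ τ : G.Plan) (t : G.Time) : Prop :=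
  τ t ≠ ρ t ∧ ∀ s, s ≠ t → τ s = ρ s

/-- Player `i` has a profitable one-shot deviation from `σ` at `t`. -/
def HasProfitablePlanOneShotDeviation (σ : Fin 2 → G.Plan) (i : Fin 2) (t : G.Time) : Prop :=
  ∃ τ : G.Plan, G.IsPlanOneShotDeviation (σ i) τ t ∧
    G.planValue σ i t < G.planValue (Function.update σ i τ) i t

/-! ### Strategies that depend on the history of play -/

/-- A public record: the past times at which actions were chosen, in order of occurrence, each with
the action profile chosen at that time. -/
abbrev History : Type := Σ n : ℕ, (Fin n → G.Time × G.Profile)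

/-- The history `h` followed by the choice of `a` at time `t`. -/
def extendHistory (h : G.History) (t : G.Time) (a : G.Profile) : G.History :=
  ⟨h.1 + 1, Fin.snoc (α := fun _ => G.Time × G.Profile) h.2 (t, a)⟩

/-- The players can choose actions at time `t` after the history `h`: the choice times recorded in
`h`, followed by `t`, begin with the starting time and their remaining lengths strictly decrease.
(With the empty history, `t` is the starting time; otherwise `t` is a revision opportunity.) -/
def IsNode (h : G.History) (t : G.Time) : Prop :=
  let times : Fin (h.1 + 1) → G.Time :=
    Fin.snoc (α := fun _ => G.Time) (fun k => (h.2 k).1) t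
  times 0 = G.start ∧ StrictAnti times

/-- A history-dependent strategy: a measurable rule that selects an action from the history and the
current time. The actions stay in a compact subset of the action set, so that payoffs are bounded
(no restriction if the action set is compact). -/
structure Strategy where
  /-- the action prescribed after a history at a time -/
  toFun : G.History → G.Time → G.A
  measurable_toFun : Measurable (Function.uncurry toFun)
  compact_range : ∃ K : Set G.A, IsCompact K ∧ ∀ h t, toFun h t ∈ K

variable {G}

/-- The action profile prescribed by `σ` after the history `h` at time `t`. -/
def action (σ : Fin 2 → G.Strategy) (h : G.History) (t : G.Time) : G.Profile :=
  fun j => (σ j).toFun h t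

/-- The integral, over all `t > s₁ > ⋯ > sₙ ≥ 0`, of the payoff of player `i` at the deadline when
`σ` is played from `(h, t)` on and the revision opportunities after `t` are exactly `s₁, …, sₙ`. -/
def arrivalIntegral (σ : Fin 2 → G.Strategy) (i : Fin 2) : ℕ → G.History → G.Time → ℝ
  | 0, h, t => G.payoff i (action σ h t)
  | n + 1, h, t =>
      ∫ s in Set.Iio t, arrivalIntegral σ i n (G.extendHistory h t (action σ h t)) s ∂G.timeMeasure

/-- Expected payoff of player `i` when `σ` is played from the node `(h, t)` on. In a Poisson process
of rate `λ`, the density of exactly `n` opportunities during the remaining length `t`, at the times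
`s₁ > ⋯ > sₙ`, is `λⁿ e^{-λ t}`. -/
def value (σ : Fin 2 → G.Strategy) (i : Fin 2) (h : G.History) (t : G.Time) : ℝ :=
  ∑' n : ℕ, Real.exp (-G.rate * t) * G.rate ^ n * arrivalIntegral σ i n h t

/-- Subgame perfection: from every node on, no strategy of a player yields more. -/
def IsSPE (σ : Fin 2 → G.Strategy) : Prop :=
  ∀ (i : Fin 2) (τ : G.Strategy) (h : G.History) (t : G.Time), G.IsNode h t →
    value (Function.update σ i τ) i h t ≤ value σ i h t

/-- `τ` is a one-shot deviation from `ρ` at `(h, t)`: it differs from `ρ` there and only there. -/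
def IsOneShotDeviation (ρ τ : G.Strategy) (h : G.History) (t : G.Time) : Prop :=
  τ.toFun h t ≠ ρ.toFun h t ∧ ∀ h' t', (h', t') ≠ (h, t) → τ.toFun h' t' = ρ.toFun h' t'

/-- Player `i` has a profitable one-shot deviation from `σ` at `(h, t)`. -/
def HasProfitableOneShotDeviation (σ : Fin 2 → G.Strategy) (i : Fin 2)
    (h : G.History) (t : G.Time) : Prop :=
  ∃ τ : G.Strategy, IsOneShotDeviation (σ i) τ h t ∧
    value σ i h t < value (Function.update σ i τ) i h t

end RevisionGame

end

open Set

/-! ### Measurability on sums of measurable spaces -/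

section Sigma

variable {ι Y Z : Type*} {X : ι → Type*} [∀ i, MeasurableSpace (X i)] [MeasurableSpace Y]
  [MeasurableSpace Z]

/-! (a) Changing a plan at one time leaves the integral unchanged, so a one-shot deviation gains
exactly when it raises the stage payoff at that time. If none gains, the payoff inequality holds
pointwise and integrates (`isPlanSPE_iff`).

(b) The number of revisions is unbounded, so there is no last decision from which to induct
backwards. Instead, `W = e^{λt} V` satisfies `W(h,t) = π(a) + λ ∫_{s<t} W(h',s) ds`, with `a` the
profile played and `h'` the extended history (`scaledValue_eq`). Without a profitable one-shot
deviation, playing `τ` once and `σ` afterwards yields at most `W_σ`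
(`scaledValue_ge_of_not_hasProfitableOneShotDeviation`). Hence `D = W_τ - W_σ` satisfies `D(h,t) ≤ λ
∫_{s<t} D(h',s) ds`. Iterating from a uniform bound `M` gives `D ≤ M (λt)^n / n!` for every `n`
(`scaledValue_sub_le`), so `D ≤ 0`. -/

theorem measurableSet_sigma {s : Set (Σ i, X i)} :
    MeasurableSet s ↔ ∀ i, MeasurableSet (Sigma.mk i ⁻¹' s) := by
  rw [MeasurableSpace.measurableSet_iInf]
  rfl

theorem measurable_sigma_mk (i : ι) : Measurable (Sigma.mk i : X i → Σ i, X i) :=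
  fun _ hs => measurableSet_sigma.1 hs i

theorem measurableEmbedding_sigma_mk (i : ι) :
    MeasurableEmbedding (Sigma.mk i : X i → Σ i, X i) where
  injective := sigma_mk_injective
  measurable := measurable_sigma_mk i
  measurableSet_image' s hs := by
    refine measurableSet_sigma.2 fun j => ?_
    by_cases hij : j = i
    · subst hij
      rwa [preimage_image_eq _ sigma_mk_injective]
    · convert MeasurableSet.empty
      ext x
      simp only [mem_preimage, mem_image, mem_empty_iff_false, iff_false, not_exists, not_and]
      intro y _ h
      exact hij (congrArg Sigma.fst h).symm

/-- Applied to histories, this keeps a strategy measurable after a change at a single node. -/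
theorem measurableSingletonClass_sigma [∀ i, MeasurableSingletonClass (X i)] :
    MeasurableSingletonClass (Σ i, X i) where
  measurableSet_singleton x := by
    rw [← Sigma.eta x, ← image_singleton]
    exact (measurableEmbedding_sigma_mk x.1).measurableSet_image' (measurableSet_singleton x.2)

theorem measurable_of_sigma_prod [Countable ι] {f : (Σ i, X i) × Y → Z}
    (hf : ∀ i, Measurable fun p : X i × Y => f (⟨i, p.1⟩, p.2)) : Measurable f := by
  intro s hs
  have h : f ⁻¹' s = ⋃ i, Prod.map (Sigma.mk i) id ''
      ((fun p : X i × Y => f (⟨i, p.1⟩, p.2)) ⁻¹' s) := by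
    ext ⟨⟨i, x⟩, y⟩
    simp only [mem_preimage, mem_iUnion, mem_image, Prod.map, Prod.mk.injEq, id]
    constructor
    · exact fun h => ⟨i, (x, y), h, rfl, rfl⟩
    · rintro ⟨j, p, hp, hx, hy⟩
      rwa [hx, hy] at hp
  rw [h]
  exact MeasurableSet.iUnion fun i =>
    ((measurableEmbedding_sigma_mk i).prodMap .id).measurableSet_image' (hf i hs)

end Sigma

namespace RevisionGame

/-! ### The measure on times -/

theorem map_timeMeasure (G : RevisionGame) :
    G.timeMeasure.map Subtype.val = volume.restrict (Icc 0 G.T) :=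
  map_comap_subtype_coe measurableSet_Icc volume

instance instIsFiniteMeasureTime (G : RevisionGame) : IsFiniteMeasure G.timeMeasure where
  measure_univ_lt_top := by
    rw [← preimage_univ (f := (Subtype.val : G.Time → ℝ)),
      ← Measure.map_apply measurable_subtype_coe MeasurableSet.univ, map_timeMeasure]
    simp

instance instNullSingletonClassTime (G : RevisionGame) :
    NullSingletonClass G.timeMeasure where
  measure_singleton x := by
    have h : ({x} : Set G.Time) = Subtype.val ⁻¹' {(x : ℝ)} := by
      ext y
      simp [Subtype.ext_iff]
    rw [h, ← Measure.map_apply measurable_subtype_coe (measurableSet_singleton _), map_timeMeasure]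
    exact measure_singleton _

theorem setIntegral_Iio_pow {G : RevisionGame} (t : G.Time) (n : ℕ) :
    ∫ s in Iio t, (s : ℝ) ^ n ∂G.timeMeasure = (t : ℝ) ^ (n + 1) / (n + 1) := by
  have hI : Iio (t : ℝ) ∩ Icc 0 G.T = Ico 0 (t : ℝ) := by
    ext x
    have := t.2.2
    simp only [mem_inter_iff, mem_Iio, mem_Icc, mem_Ico]
    constructor
    · rintro ⟨h1, h2, _⟩
      exact ⟨h2, h1⟩
    · rintro ⟨h1, h2⟩
      exact ⟨h2, h1, by linarith⟩
  have h := (MeasurableEmbedding.subtype_coe (measurableSet_Icc (a := (0 : ℝ)) (b := G.T))).setIntegral_map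
    (μ := G.timeMeasure) (fun x : ℝ => x ^ n) (Iio (t : ℝ))
  rw [map_timeMeasure, Measure.restrict_restrict measurableSet_Iio, hI, integral_Ico_eq_integral_Ioc,
    ← intervalIntegral.integral_of_le t.2.1, integral_pow] at h
  rw [show Iio t = Subtype.val ⁻¹' Iio (t : ℝ) from rfl, ← h]
  simp

/-! ### Strategies that are functions of time -/

section Plan

variable {G : RevisionGame}

theorem measurable_update_of_measurable {ρ : G.Plan} (hρ : Measurable ρ) (t : G.Time) (a : G.A) :
    Measurable (Function.update ρ t a) := by
  classical
  have h : Function.update ρ t a = fun s => if s = t then a else ρ s := by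
    funext s
    rw [Function.update_apply]
  rw [h]
  exact Measurable.ite (measurableSet_singleton t) measurable_const hρ

theorem planValue_update_of_isPlanOneShotDeviation {σ : Fin 2 → G.Plan} {i : Fin 2} {τ : G.Plan}
    {t : G.Time} (h : ∀ s, s ≠ t → τ s = σ i s) :
    G.planValue (Function.update σ i τ) i t - G.planValue σ i t =
      (G.payoff i (fun j => Function.update σ i τ j t) - G.payoff i (fun j => σ j t)) *
        Real.exp (-G.rate * t) := by
  have hI : ∫ s in Iic t, G.payoff i (fun j => Function.update σ i τ j s) *
        (G.rate * Real.exp (-G.rate * s)) ∂G.timeMeasure =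
      ∫ s in Iic t, G.payoff i (fun j => σ j s) *
        (G.rate * Real.exp (-G.rate * s)) ∂G.timeMeasure := by
    refine integral_congr_ae (ae_restrict_of_ae ?_)
    filter_upwards [compl_mem_ae_iff.2 (measure_singleton (μ := G.timeMeasure) t)] with s hs
    have : (fun j => Function.update σ i τ j s) = fun j => σ j s := by
      funext j
      rcases eq_or_ne j i with rfl | hj
      · simpa using h s hs
      · simp [hj]
    rw [this]
  unfold planValue
  rw [hI]
  ring

/-- One-shot deviations are arbitrary maps, whereas `IsPlanSPE` tests only well-defined ones; a
one-point change preserves measurability and integrability. -/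
theorem PlanWellDefined.update_one {σ : Fin 2 → G.Plan} {i : Fin 2} (hσ : G.PlanWellDefined σ i)
    {τ : G.Plan} {t : G.Time} (h : ∀ s, s ≠ t → τ s = σ i s) :
    G.PlanWellDefined (Function.update σ i τ) i := by
  classical
  have hτ : τ = Function.update (σ i) t (τ t) := by
    funext s
    by_cases hs : s = t
    · subst hs; simp
    · simp [hs, h s hs]
  refine ⟨fun j => ?_, ?_⟩
  · rcases eq_or_ne j i with rfl | hj
    · rw [Function.update_self, hτ]
      exact measurable_update_of_measurable (hσ.1 j) t (τ t)
    · simpa [hj] using hσ.1 j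
  · refine hσ.2.congr ?_
    filter_upwards [compl_mem_ae_iff.2 (measure_singleton (μ := G.timeMeasure) t)] with s hs
    congr 1
    funext j
    rcases eq_or_ne j i with rfl | hj
    · simpa using (h s hs).symm
    · simp [hj]

theorem integrable_mul_density {f : G.Time → ℝ} (hf : Integrable f G.timeMeasure) :
    Integrable (fun s : G.Time => f s * (G.rate * Real.exp (-G.rate * s))) G.timeMeasure := by
  refine hf.mul_bdd (c := G.rate) (by fun_prop) (Filter.Eventually.of_forall fun s => ?_)
  have hr := G.rate_pos
  rw [Real.norm_eq_abs, abs_of_pos (by positivity)]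
  have : Real.exp (-G.rate * s) ≤ 1 :=
    Real.exp_le_one_iff.2 (by nlinarith [mul_nonneg hr.le s.2.1])
  nlinarith

/-- Only `τ t` matters: splicing this value into `σ i` gives a one-shot deviation, unless the two
actions at `t` agree. -/
theorem payoff_le_of_not_hasProfitablePlanOneShotDeviation {σ : Fin 2 → G.Plan} {i : Fin 2}
    {t : G.Time} (h : ¬ G.HasProfitablePlanOneShotDeviation σ i t) (τ : G.Plan) :
    G.payoff i (fun j => Function.update σ i τ j t) ≤ G.payoff i (fun j => σ j t) := by
  classical
  by_cases ha : τ t = σ i t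
  · refine le_of_eq (congrArg _ (funext fun j => ?_))
    rcases eq_or_ne j i with rfl | hj
    · simpa using ha
    · simp [hj]
  · by_contra! hlt
    have hne : ∀ s, s ≠ t → Function.update (σ i) t (τ t) s = σ i s := fun s hs => by simp [hs]
    refine h ⟨Function.update (σ i) t (τ t), ⟨by simpa using ha, hne⟩, ?_⟩
    have hv := planValue_update_of_isPlanOneShotDeviation hne
    have hp : (fun j => Function.update σ i (Function.update (σ i) t (τ t)) j t) =
        fun j => Function.update σ i τ j t := by
      funext j
      rcases eq_or_ne j i with rfl | hj
      · simp
      · simp [hj]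
    rw [hp] at hv
    have := mul_pos (sub_pos.2 hlt) (Real.exp_pos (-G.rate * t))
    linarith

theorem isPlanSPE_iff {σ : Fin 2 → G.Plan} (hσ : ∀ i, G.PlanWellDefined σ i) :
    G.IsPlanSPE σ ↔
      ¬ ∃ (i : Fin 2) (t : G.Time), G.HasProfitablePlanOneShotDeviation σ i t := by
  constructor
  · rintro hS ⟨i, t, τ, hτ, hlt⟩
    exact (hS i τ ((hσ i).update_one hτ.2) t).not_gt hlt
  · intro hD i τ hτ t
    have hle : ∀ s, G.payoff i (fun j => Function.update σ i τ j s) ≤ G.payoff i (fun j => σ j s) :=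
      fun s => payoff_le_of_not_hasProfitablePlanOneShotDeviation (fun h => hD ⟨i, s, h⟩) τ
    have hr := G.rate_pos
    refine add_le_add (mul_le_mul_of_nonneg_right (hle t) (Real.exp_nonneg _)) ?_
    exact setIntegral_mono (integrable_mul_density hτ.2).integrableOn
      (integrable_mul_density (hσ i).2).integrableOn
      fun s => mul_le_mul_of_nonneg_right (hle s) (by positivity)

end Plan

/-! ### Strategies that depend on the history of play -/

section History

variable {G : RevisionGame}

/-! ### Measurability of continuation payoffs -/

theorem measurable_payoff (i : Fin 2) : Measurable (G.payoff i) :=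
  (G.payoff_continuous i).measurable

theorem measurable_action (σ : Fin 2 → G.Strategy) :
    Measurable fun p : G.History × G.Time => action σ p.1 p.2 :=
  measurable_pi_lambda _ fun j => (σ j).measurable_toFun

theorem measurable_extendHistory :
    Measurable fun p : G.History × G.Time × G.Profile => G.extendHistory p.1 p.2.1 p.2.2 := by
  refine measurable_of_sigma_prod fun n => (measurable_sigma_mk (n + 1)).comp ?_
  refine measurable_pi_lambda _ fun k => ?_
  induction k using Fin.lastCases with
  | last => simpa using measurable_snd
  | cast k => simpa using! (measurable_pi_apply k).comp measurable_fst

theorem measurable_arrivalIntegral (σ : Fin 2 → G.Strategy) (i : Fin 2) (n : ℕ) :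
    Measurable fun p : G.History × G.Time => arrivalIntegral σ i n p.1 p.2 := by
  induction n with
  | zero => exact (measurable_payoff i).comp (measurable_action σ)
  | succ n ih =>
    have hE : Measurable fun q : (G.History × G.Time) × G.Time =>
        (G.extendHistory q.1.1 q.1.2 (action σ q.1.1 q.1.2), q.2) := by
      refine Measurable.prodMk ?_ measurable_snd
      exact measurable_extendHistory.comp ((measurable_fst.comp measurable_fst).prodMk
        ((measurable_snd.comp measurable_fst).prodMk ((measurable_action σ).comp measurable_fst)))
    -- The domain `Iio t` varies with the parameter, so it enters the integrand as an indicator.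
    have hS : MeasurableSet {q : (G.History × G.Time) × G.Time | q.2 < q.1.2} :=
      measurableSet_lt measurable_snd (measurable_snd.comp measurable_fst)
    have := ((ih.comp hE).indicator hS).stronglyMeasurable.integral_prod_right'
      (ν := G.timeMeasure)
    convert this.measurable using 2 with p
    rw [arrivalIntegral, ← integral_indicator measurableSet_Iio]
    rfl

/-! ### Bounds, summability and the recursion for the value -/

theorem exists_abs_payoff_le (σ : Fin 2 → G.Strategy) (i : Fin 2) :
    ∃ C, ∀ h t, |G.payoff i (action σ h t)| ≤ C := by
  choose K hK hσ using fun j => (σ j).compact_range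
  obtain ⟨C, hC⟩ := (isCompact_univ_pi hK).exists_bound_of_continuousOn
    (G.payoff_continuous i).continuousOn
  exact ⟨C, fun h t => hC _ fun j _ => hσ j h t⟩

theorem integrable_of_abs_le {f : G.Time → ℝ} (hf : Measurable f) {C : ℝ} (hC : ∀ s, |f s| ≤ C) :
    Integrable f G.timeMeasure :=
  .of_bound hf.aestronglyMeasurable C (Filter.Eventually.of_forall hC)

theorem integrable_pow (n : ℕ) : Integrable (fun s : G.Time => (s : ℝ) ^ n) G.timeMeasure :=
  integrable_of_abs_le (by fun_prop) (C := G.T ^ n) fun s => by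
    rw [abs_of_nonneg (pow_nonneg s.2.1 n)]
    exact pow_le_pow_left₀ s.2.1 s.2.2 n

theorem setIntegral_Iio_mul_pow_div_factorial (C : ℝ) (n : ℕ) (t : G.Time) :
    ∫ s in Iio t, C * (s : ℝ) ^ n / n.factorial ∂G.timeMeasure =
      C * (t : ℝ) ^ (n + 1) / (n + 1).factorial := by
  rw [integral_div, integral_const_mul, setIntegral_Iio_pow, Nat.factorial_succ]
  push_cast
  field_simp

/-- The simplex `t > s₁ > ⋯ > sₙ ≥ 0` has volume `tⁿ / n!`. -/
theorem abs_arrivalIntegral_le {σ : Fin 2 → G.Strategy} {i : Fin 2} {C : ℝ}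
    (hC : ∀ h t, |G.payoff i (action σ h t)| ≤ C) (n : ℕ) (h : G.History) (t : G.Time) :
    |arrivalIntegral σ i n h t| ≤ C * (t : ℝ) ^ n / n.factorial := by
  induction n generalizing h t with
  | zero => simpa [arrivalIntegral] using hC h t
  | succ n ih =>
    rw [arrivalIntegral, ← setIntegral_Iio_mul_pow_div_factorial, ← Real.norm_eq_abs]
    exact norm_integral_le_of_norm_le (((integrable_pow n).const_mul C).div_const _).integrableOn
      (Filter.Eventually.of_forall fun s => ih _ s)

/-- The expected payoff, without the discount factor `e^{-λ t}`. -/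
noncomputable def scaledValue (σ : Fin 2 → G.Strategy) (i : Fin 2) (h : G.History) (t : G.Time) : ℝ :=
  ∑' n : ℕ, G.rate ^ n * arrivalIntegral σ i n h t

theorem value_eq (σ : Fin 2 → G.Strategy) (i : Fin 2) (h : G.History) (t : G.Time) :
    value σ i h t = Real.exp (-G.rate * t) * scaledValue σ i h t := by
  simp only [value, scaledValue, mul_assoc, tsum_mul_left]

theorem abs_scaled_term_le {σ : Fin 2 → G.Strategy} {i : Fin 2} {C : ℝ}
    (hC : ∀ h t, |G.payoff i (action σ h t)| ≤ C) (n : ℕ) (h : G.History) (t : G.Time) :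
    |G.rate ^ n * arrivalIntegral σ i n h t| ≤ C * ((G.rate * G.T) ^ n / n.factorial) := by
  have hr := G.rate_pos
  have hC0 : 0 ≤ C := (abs_nonneg _).trans (hC h t)
  rw [abs_mul, abs_of_pos (pow_pos hr n), mul_pow]
  calc _ ≤ G.rate ^ n * (C * (t : ℝ) ^ n / n.factorial) := by
        gcongr
        exact abs_arrivalIntegral_le hC n h t
    _ ≤ G.rate ^ n * (C * G.T ^ n / n.factorial) := by
        have := t.2.1
        have := t.2.2
        gcongr
    _ = _ := by ring

theorem summable_scaled_term (σ : Fin 2 → G.Strategy) (i : Fin 2) (h : G.History) (t : G.Time) :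
    Summable fun n : ℕ => G.rate ^ n * arrivalIntegral σ i n h t := by
  obtain ⟨C, hC⟩ := exists_abs_payoff_le σ i
  exact .of_norm_bounded ((Real.summable_pow_div_factorial (G.rate * G.T)).mul_left C)
    fun n => abs_scaled_term_le hC n h t

theorem exists_abs_scaledValue_le (σ : Fin 2 → G.Strategy) (i : Fin 2) :
    ∃ C, ∀ h t, |scaledValue σ i h t| ≤ C := by
  obtain ⟨C, hC⟩ := exists_abs_payoff_le σ i
  exact ⟨∑' n : ℕ, C * ((G.rate * G.T) ^ n / n.factorial), fun h t => tsum_of_norm_bounded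
    (f := fun n => G.rate ^ n * arrivalIntegral σ i n h t)
    ((Real.summable_pow_div_factorial (G.rate * G.T)).mul_left C).hasSum
    fun n => abs_scaled_term_le hC n h t⟩

theorem integrable_arrivalIntegral (σ : Fin 2 → G.Strategy) (i : Fin 2) (n : ℕ) (h : G.History) :
    Integrable (arrivalIntegral σ i n h) G.timeMeasure := by
  obtain ⟨C, hC⟩ := exists_abs_payoff_le σ i
  have hm : Measurable (arrivalIntegral σ i n h) :=
    (measurable_arrivalIntegral σ i n).comp measurable_prodMk_left
  exact (((integrable_pow n).const_mul C).div_const _).mono' hm.aestronglyMeasurable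
    (Filter.Eventually.of_forall fun s => abs_arrivalIntegral_le hC n h s)

theorem integrable_scaledValue (σ : Fin 2 → G.Strategy) (i : Fin 2) (h : G.History) :
    Integrable (scaledValue σ i h) G.timeMeasure := by
  obtain ⟨C, hC⟩ := exists_abs_scaledValue_le σ i
  refine integrable_of_abs_le ?_ (hC h)
  exact measurable_of_tendsto_metrizable
    (fun N => Finset.measurable_sum (Finset.range N) fun n _ => ((measurable_arrivalIntegral σ i n).comp
      measurable_prodMk_left).const_mul (G.rate ^ n))
    (tendsto_pi_nhds.2 fun t => by
      simpa [scaledValue] using (summable_scaled_term σ i h t).hasSum.tendsto_sum_nat)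

/-- The term `n = 0` is the payoff without further revision; the others are integrals over the time
of the next one. The bounds `C (λT)^n / n!` justify exchanging sum and integral. -/
theorem scaledValue_eq (σ : Fin 2 → G.Strategy) (i : Fin 2) (h : G.History) (t : G.Time) :
    scaledValue σ i h t = G.payoff i (action σ h t) + G.rate *
      ∫ s in Iio t, scaledValue σ i (G.extendHistory h t (action σ h t)) s ∂G.timeMeasure := by
  obtain ⟨C, hC⟩ := exists_abs_payoff_le σ i
  set h' := G.extendHistory h t (action σ h t) with hh'
  have hsum : ∑' n, ∫ s in Iio t, G.rate ^ n * arrivalIntegral σ i n h' s ∂G.timeMeasure =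
      ∫ s in Iio t, scaledValue σ i h' s ∂G.timeMeasure := by
    refine integral_tsum_of_summable_integral_norm
      (fun n => ((integrable_arrivalIntegral σ i n h').const_mul _).integrableOn) ?_
    refine .of_nonneg_of_le (fun n => by positivity) (fun n => ?_)
      (((Real.summable_pow_div_factorial (G.rate * G.T)).mul_left C).mul_left
        (G.timeMeasure.real (Iio t)))
    rw [← smul_eq_mul, ← setIntegral_const]
    exact setIntegral_mono (((integrable_arrivalIntegral σ i n h').const_mul _).norm.integrableOn)
      (integrable_const _) fun s => abs_scaled_term_le hC n h' s
  rw [scaledValue, (summable_scaled_term σ i h t).tsum_eq_zero_add, ← hsum, ← tsum_mul_left]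
  simp only [pow_zero, one_mul, arrivalIntegral, pow_succ', integral_const_mul, mul_assoc, ← hh']

/-- Histories only grow during play, so shorter ones are never consulted again. -/
theorem scaledValue_congr {σ τ : Fin 2 → G.Strategy} {i : Fin 2} {m : ℕ}
    (hστ : ∀ h t, m ≤ h.1 → action σ h t = action τ h t) {h : G.History} (hm : m ≤ h.1)
    (t : G.Time) : scaledValue σ i h t = scaledValue τ i h t := by
  have key : ∀ n (h : G.History), m ≤ h.1 → ∀ t,
      arrivalIntegral σ i n h t = arrivalIntegral τ i n h t := by
    intro n
    induction n with
    | zero => intro h hm t; simp only [arrivalIntegral, hστ h t hm]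
    | succ n ih =>
      intro h hm t
      simp only [arrivalIntegral, hστ h t hm]
      congr 1
      funext s
      exact ih _ (Nat.le_succ_of_le hm) s
  simp only [scaledValue, key _ h hm t]

/-! ### Nodes, deviations and the iteration -/

theorem IsNode.extendHistory {h : G.History} {t : G.Time} (hn : G.IsNode h t) (a : G.Profile)
    {s : G.Time} (hs : s < t) : G.IsNode (G.extendHistory h t a) s := by
  obtain ⟨n, x⟩ := h
  obtain ⟨h0, hanti⟩ := hn
  have hsnoc : (fun k : Fin (n + 1) =>
      ((Fin.snoc (α := fun _ => G.Time × G.Profile) x (t, a) : Fin (n + 1) → _) k).1) =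
      Fin.snoc (α := fun _ => G.Time) (fun k => (x k).1) t := by
    funext k
    induction k using Fin.lastCases <;> simp
  unfold IsNode RevisionGame.extendHistory
  simp only [hsnoc]
  refine ⟨?_, ?_⟩
  · rw [← Fin.castSucc_zero, Fin.snoc_castSucc]
    exact h0
  · rw [Fin.strictAnti_iff_succ_lt]
    intro k
    rw [Fin.snoc_castSucc]
    induction k using Fin.lastCases with
    | last => simpa using hs
    | cast k =>
      rw [Fin.succ_castSucc, Fin.snoc_castSucc]
      exact Fin.strictAnti_iff_succ_lt.1 hanti k

/-- The strategy `ρ`, changed at `(h, t)` to the action `a`. -/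
noncomputable def Strategy.deviate (ρ : G.Strategy) (h : G.History) (t : G.Time) (a : G.A) : G.Strategy where
  toFun h' t' := open Classical in if (h', t') = (h, t) then a else ρ.toFun h' t'
  measurable_toFun := by
    classical
    have : MeasurableSingletonClass G.History := measurableSingletonClass_sigma
    exact (measurable_const (a := a)).ite (measurableSet_singleton (h, t)) ρ.measurable_toFun
  compact_range := by
    obtain ⟨K, hK, hρ⟩ := ρ.compact_range
    refine ⟨insert a K, hK.insert a, fun h' t' => ?_⟩
    split_ifs
    · exact mem_insert a K
    · exact mem_insert_of_mem a (hρ h' t')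

theorem scaledValue_ge_of_not_hasProfitableOneShotDeviation {σ : Fin 2 → G.Strategy} {i : Fin 2}
    {h : G.History} {t : G.Time} (hD : ¬ HasProfitableOneShotDeviation σ i h t) (τ : G.Strategy) :
    G.payoff i (action (Function.update σ i τ) h t) + G.rate * ∫ s in Iio t, scaledValue σ i
      (G.extendHistory h t (action (Function.update σ i τ) h t)) s ∂G.timeMeasure ≤
        scaledValue σ i h t := by
  by_cases ha : τ.toFun h t = (σ i).toFun h t
  · have : action (Function.update σ i τ) h t = action σ h t := by
      funext j
      rcases eq_or_ne j i with rfl | hj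
      · simpa [action] using ha
      · simp [action, hj]
    rw [this, ← scaledValue_eq]
  · set ρ := (σ i).deviate h t (τ.toFun h t) with hρ
    have hat : ρ.toFun h t = τ.toFun h t := by simp [hρ, Strategy.deviate]
    have hoff : ∀ h' t', (h', t') ≠ (h, t) → ρ.toFun h' t' = (σ i).toFun h' t' :=
      fun h' t' hne => by simp only [hρ, Strategy.deviate, if_neg hne]
    have hact : action (Function.update σ i ρ) h t = action (Function.update σ i τ) h t := by
      funext j
      rcases eq_or_ne j i with rfl | hj
      · simpa [action] using hat
      · simp [action, hj]
    -- Every later history is strictly longer than `h`, so the deviation is invisible after `t`.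
    have hcont : ∀ h' t', h.1 + 1 ≤ h'.1 →
        action (Function.update σ i ρ) h' t' = action σ h' t' := by
      intro h' t' hlen
      funext j
      rcases eq_or_ne j i with rfl | hj
      · have hne : (h', t') ≠ (h, t) := by
          intro he
          rw [(Prod.mk.inj he).1] at hlen
          exact Nat.not_succ_le_self _ hlen
        simpa [action] using hoff h' t' hne
      · simp [action, hj]
    have hle : value (Function.update σ i ρ) i h t ≤ value σ i h t := by
      by_contra! hlt
      exact hD ⟨ρ, ⟨by rwa [hat], hoff⟩, hlt⟩
    rw [value_eq, value_eq, mul_le_mul_iff_right₀ (Real.exp_pos _), scaledValue_eq, hact] at hle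
    simpa only [scaledValue_congr hcont (h := G.extendHistory h t _) le_rfl] using hle

theorem scaledValue_sub_le {σ : Fin 2 → G.Strategy} {i : Fin 2}
    (hD : ∀ h t, G.IsNode h t → ¬ HasProfitableOneShotDeviation σ i h t) (τ : G.Strategy)
    {M : ℝ} (hM : ∀ h t, scaledValue (Function.update σ i τ) i h t - scaledValue σ i h t ≤ M)
    (n : ℕ) {h : G.History} {t : G.Time} (hn : G.IsNode h t) :
    scaledValue (Function.update σ i τ) i h t - scaledValue σ i h t ≤
      M * G.rate ^ n * (t : ℝ) ^ n / n.factorial := by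
  induction n generalizing h t with
  | zero => simpa using hM h t
  | succ n ih =>
    have hr := G.rate_pos
    set h' := G.extendHistory h t (action (Function.update σ i τ) h t) with hh'
    have h1 := scaledValue_eq (Function.update σ i τ) i h t
    have h2 := scaledValue_ge_of_not_hasProfitableOneShotDeviation (hD h t hn) τ
    rw [← hh'] at h1 h2
    have h3 : ∫ s in Iio t,
        (scaledValue (Function.update σ i τ) i h' s - scaledValue σ i h' s) ∂G.timeMeasure ≤
        ∫ s in Iio t, M * G.rate ^ n * (s : ℝ) ^ n / n.factorial ∂G.timeMeasure :=
      -- The comparison is needed only for `s < t`, where the extended history is again a node.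
      setIntegral_mono_on
        ((integrable_scaledValue _ i h').sub (integrable_scaledValue σ i h')).integrableOn
        (((integrable_pow n).const_mul _).div_const _).integrableOn measurableSet_Iio
        fun s hs => ih (hn.extendHistory _ hs)
    rw [integral_sub (integrable_scaledValue _ i h').integrableOn
      (integrable_scaledValue σ i h').integrableOn, setIntegral_Iio_mul_pow_div_factorial] at h3
    have h4 := mul_le_mul_of_nonneg_left h3 hr.le
    have h5 : M * G.rate ^ (n + 1) * (t : ℝ) ^ (n + 1) / (n + 1).factorial =
        G.rate * (M * G.rate ^ n * (t : ℝ) ^ (n + 1) / (n + 1).factorial) := by ring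
    rw [h5]
    linarith

theorem isSPE_iff (σ : Fin 2 → G.Strategy) :
    IsSPE σ ↔ ¬ ∃ (i : Fin 2) (h : G.History) (t : G.Time),
      G.IsNode h t ∧ HasProfitableOneShotDeviation σ i h t := by
  constructor
  · rintro hS ⟨i, h, t, hn, τ, _, hlt⟩
    exact (hS i τ h t hn).not_gt hlt
  · intro hD i τ h t hn
    rw [value_eq, value_eq]
    refine mul_le_mul_of_nonneg_left ?_ (Real.exp_nonneg _)
    obtain ⟨C, hC⟩ := exists_abs_scaledValue_le (Function.update σ i τ) i
    obtain ⟨C', hC'⟩ := exists_abs_scaledValue_le σ i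
    -- `C + C'` bounds the difference at all pairs, nodes or not, which starts the iteration.
    have hbound := fun n => scaledValue_sub_le (M := C + C')
      (fun h t hn hp => hD ⟨i, h, t, hn, hp⟩) τ
      (fun h t => by linarith [abs_le.1 (hC h t), abs_le.1 (hC' h t)]) n hn
    have hlim : Filter.Tendsto (fun n : ℕ => (C + C') * G.rate ^ n * (t : ℝ) ^ n / n.factorial)
        Filter.atTop (nhds 0) := by
      have := ((Real.summable_pow_div_factorial (G.rate * t)).mul_left
        (C + C')).tendsto_atTop_zero
      refine this.congr fun n => ?_
      rw [mul_pow]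
      ring
    exact sub_nonpos.1 (ge_of_tendsto' hlim hbound)

end History

end RevisionGame

theorem lemma1 (G : RevisionGame) :
    (∀ σ : Fin 2 → G.Plan, (∀ i, G.PlanWellDefined σ i) →
      (G.IsPlanSPE σ ↔
        ¬ ∃ (i : Fin 2) (t : G.Time), G.HasProfitablePlanOneShotDeviation σ i t)) ∧
    (∀ σ : Fin 2 → G.Strategy,
      (RevisionGame.IsSPE σ ↔
        ¬ ∃ (i : Fin 2) (h : G.History) (t : G.Time),
          G.IsNode h t ∧ RevisionGame.HasProfitableOneShotDeviation σ i h t)) := by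
  exact ⟨fun σ hσ => RevisionGame.isPlanSPE_iff hσ, fun σ => RevisionGame.isSPE_iff σ⟩
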